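/- Let $a,b,c,d$ be real numbers and consider the doubly confluent Heun equation $$x^2y''(x)+(cx+d)y'(x)-(ax+b)y(x)=0,\qquad 0<x<\infty.\tag{1}$$ (i) If $d>0$, then (1) has a unique solution $\hat y_1$ on $(0,\infty)$ such that, as $x\to0^+$, $$\hat y_1(x)\sim\sum_{k=0}^\infty A_kx^k,\tag{2}$$ where $A_{-1}=0$, $A_0=1$ and, for $k\ge1$, $$A_k=\frac{b+(k+c-2)(1-k)}{kd}A_{k-1}+\frac{a}{kd}A_{k-2}.$$ (ii) If $d<0$, then (1) has a unique solution $y_1$ on $(0,\infty)$ such that, as $x\to0^+$, $$y_1(x)\sim e^{d/x}x^{2-c}\sum_{k=0}^\infty A_kx^k,\tag{3}$$ where $A_{-1}=0$, $A_0=1$ and, for $k\ge1$, $$A_k=\frac{(k-c+1)k-b}{kd}A_{k-1}-\frac{a}{kd}A_{k-2}.$$ Here $y\sim\varphi\sum_k A_kx^k$ means that $y(x)-\varphi(x)\sum_{k<n}A_kx^k=O(\varphi(x)x^n)$ as $x\to0^+$ for every $n\ge0$. The asymptotic formulas (2) and (3) may be differentiated term by term any number of times: the solutions are smooth on $(0,\infty)$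 and, for all $m,n\ge0$, as $x\to0^+$, $$\hat y_1^{(m)}(x)-\sum_{k<n}\frac{d^m}{dx^m}\bigl(A_kx^k\bigr)=O\bigl(x^{n-m}\bigr),\qquad y_1^{(m)}(x)-\sum_{k<n}\frac{d^m}{dx^m}\bigl(A_ke^{d/x}x^{2-c+k}\bigr)=O\bigl(e^{d/x}x^{2-c+n-2m}\bigr)$$ in cases (i) and (ii) respectively. If $a>0$ and $b\ge0$, then $\hat y_1$ (when $d>0$) and $y_1$ (when $d<0$) are positive and strictly increasing on $(0,\infty)$. -/

import Mathlib

open Filter Topology Asymptotics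
open scoped ContDiff

/-- `y` is a (twice differentiable) solution on `(0, ∞)` of the doubly confluent Heun equation
`x² y'' + (c x + d) y' - (a x + b) y = 0`.  Only the values of `y` on `(0, ∞)` matter. -/
def IsDCHESolution (a b c d : ℝ) (y : ℝ → ℝ) : Prop :=
  ∀ x : ℝ, 0 < x →
    DifferentiableAt ℝ y x ∧ DifferentiableAt ℝ (deriv y) x ∧
      x ^ 2 * deriv (deriv y) x + (c * x + d) * deriv y x - (a * x + b) * y x = 0

/-- The sequence with `A₀ = 1` and `A_k = p_k A_{k-1} + q_k A_{k-2}` for `k ≥ 1`,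
where `A_{-1} = 0`. -/
def recCoeff (p q : ℕ → ℝ) : ℕ → ℝ
  | 0 => 1
  | 1 => p 1
  | k + 2 => p (k + 2) * recCoeff p q (k + 1) + q (k + 2) * recCoeff p q k

/-- Coefficients of the expansion for `d > 0`. -/
noncomputable def coeffPos (a b c d : ℝ) : ℕ → ℝ :=
  recCoeff (fun k => (b + ((k : ℝ) + c - 2) * (1 - (k : ℝ))) / ((k : ℝ) * d))
    (fun k => a / ((k : ℝ) * d))

/-- Coefficients of the expansion for `d < 0`. -/
noncomputable def coeffNeg (a b c d : ℝ) : ℕ → ℝ :=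
  recCoeff (fun k => (((k : ℝ) - c + 1) * (k : ℝ) - b) / ((k : ℝ) * d))
    (fun k => -(a / ((k : ℝ) * d)))

/-- `f ~ ∑ t_k` as `x → 0⁺` with respect to the scale `g`: for every `n`, the remainder after the
terms `t_0, …, t_{n-1}` is `O(g_n)`. -/
def IsAsymptoticSeries (f : ℝ → ℝ) (t g : ℕ → ℝ → ℝ) : Prop :=
  ∀ n : ℕ, (fun x => f x - ∑ k ∈ Finset.range n, t k x) =O[𝓝[>] (0 : ℝ)] g n

/-- `y ~ ∑ A_k x^k` as `x → 0⁺`. -/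
def ExpansionPos (A : ℕ → ℝ) (y : ℝ → ℝ) : Prop :=
  IsAsymptoticSeries y (fun k x => A k * x ^ k) (fun n x => x ^ n)

/-- `y ~ e^{d/x} x^{2-c} ∑ A_k x^k` as `x → 0⁺`. -/
def ExpansionNeg (c d : ℝ) (A : ℕ → ℝ) (y : ℝ → ℝ) : Prop :=
  IsAsymptoticSeries y (fun k x => Real.exp (d / x) * x ^ (2 - c) * (A k * x ^ k))
    (fun n x => Real.exp (d / x) * x ^ (2 - c) * x ^ n)

/-- `y ~ ∑ A_k x^k` may be differentiated term by term any number of times: `y` is smooth on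
`(0, ∞)` and, for each `m`, `y^(m) ~ ∑ (A_k x^k)^(m)`, where the `n`-th remainder is
`O(x^{n-m})`. -/
def TermwiseDiffPos (A : ℕ → ℝ) (y : ℝ → ℝ) : Prop :=
  ContDiffOn ℝ ∞ y (Set.Ioi 0) ∧
    ∀ m : ℕ, IsAsymptoticSeries (iteratedDeriv m y)
      (fun k => iteratedDeriv m (fun x => A k * x ^ k))
      (fun n x => x ^ ((n : ℤ) - (m : ℤ)))

/-- `y ~ e^{d/x} x^{2-c} ∑ A_k x^k` may be differentiated term by term any number of times: `y` is
smooth on `(0, ∞)` and, for each `m`, `y^(m) ~ ∑ (A_k e^{d/x} x^{2-c+k})^(m)`.  As each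
differentiation of `e^{d/x}` brings in a factor `-d/x²`, the `n`-th remainder is
`O(e^{d/x} x^{2-c} x^{n-2m})`. -/
def TermwiseDiffNeg (c d : ℝ) (A : ℕ → ℝ) (y : ℝ → ℝ) : Prop :=
  ContDiffOn ℝ ∞ y (Set.Ioi 0) ∧
    ∀ m : ℕ, IsAsymptoticSeries (iteratedDeriv m y)
      (fun k => iteratedDeriv m (fun x => Real.exp (d / x) * x ^ (2 - c) * (A k * x ^ k)))
      (fun n x => Real.exp (d / x) * x ^ (2 - c) * x ^ ((n : ℤ) - 2 * (m : ℤ)))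

/-- `y` is positive and strictly increasing on `(0, ∞)`. -/
def PositiveIncreasing (y : ℝ → ℝ) : Prop :=
  (∀ x : ℝ, 0 < x → 0 < y x) ∧ StrictMonoOn y (Set.Ioi 0)

/-!
For `d > 0` the point `0` is an irregular singular point at which all solutions but a
one-dimensional family blow up like `exp (d / x)`.  With the integrating factor
`p x = x ^ c * exp (-d / x)`, which is exponentially small at `0`, the equation reads
`(p * y')' = p * x⁻² * (a * x + b) * y`.  Everything rests on the comparison
`abs_le_of_first_order`: if `|x² v' + (c x + d) v| ≤ M` on `(0, x]` and `p * v` is not bounded away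
from `0` near `0`, then `|v x|` is at most a constant times `M`.

* Existence (`exists_solution`).  Successive approximation from `y = 1`, integrating twice from `0`,
  produces terms bounded by `(K x) ^ n / n!` on each `(0, R]`; their sum is a solution on all of
  `(0, ∞)` that tends to `1` and has bounded derivative.
* Uniqueness (`solution_eq_zero`).  A solution that is `O(x)` satisfies the same factorial bounds
  for every `n`, hence vanishes.
* Expansion (`termwiseDiffPos_of_solution`).  The differentiated equations are of the same form, with
  `c` replaced by `c + 2 m`, so the comparison bounds every derivative of `y` near `0`.  Letting
  `x → 0` in these equations shows that `y^(m)` tends to `m! A_m`, with `A_m` given by the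
  recurrence, and integrating from `0` gives the remainder estimates for all derivatives at once.
* Sign of `d` (`hasDerivAt_conjugate`).  For `d < 0` the substitution
  `y = exp (d / x) * x ^ (2 - c) * u` leads to the equation with parameters
  `a, b - 2 + c, 4 - c, -d`.  The remainder estimates for `y` follow from those for `u` because each
  differentiation of `exp (d / x) * x ^ (2 - c) * r` costs at most two powers of `x`
  (`IsSymbolTower.iteratedDeriv_mul`).
* Monotonicity (`positiveIncreasing_of_solution`).  In both cases `p * y'` has a nonnegative limit
  at `0`, namely `0` or `-d`, and it increases as long as `y > 0`; so `y` has no first zero.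
-/

/-! ### The integrating factor and first-order comparison -/

/-- The integrating factor `x ^ c * exp (-d / x)`: on `(0, ∞)` it turns
`x ^ 2 * v' + (c * x + d) * v` into `x ^ 2 / weight * (weight * v)'`. -/
noncomputable def dcheWeight (c d x : ℝ) : ℝ := x ^ c * Real.exp (-d / x)

lemma dcheWeight_pos (c d : ℝ) {x : ℝ} (hx : 0 < x) : 0 < dcheWeight c d x :=
  mul_pos (Real.rpow_pos_of_pos hx c) (Real.exp_pos _)

lemma hasDerivAt_dcheWeight (c d : ℝ) {x : ℝ} (hx : 0 < x) :
    HasDerivAt (dcheWeight c d) (dcheWeight c d x * ((c * x + d) / x ^ 2)) x := by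
  have h1 : HasDerivAt (fun x : ℝ => x ^ c) (c * x ^ (c - 1)) x :=
    Real.hasDerivAt_rpow_const (Or.inl hx.ne')
  have h2 : HasDerivAt (fun x : ℝ => -d / x) (d / x ^ 2) x := by
    have := (hasDerivAt_inv hx.ne').const_mul (-d)
    refine (this.congr_deriv ?_).congr_of_eventuallyEq ?_
    · field_simp
    · exact Eventually.of_forall fun s => by simp [div_eq_mul_inv]
  refine (h1.mul h2.exp).congr_deriv ?_
  rw [Real.rpow_sub_one hx.ne']
  unfold dcheWeight
  field_simp

lemma contDiffAt_dcheWeight (c d : ℝ) {x : ℝ} (hx : 0 < x) {n : WithTop ℕ∞} :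
    ContDiffAt ℝ n (dcheWeight c d) x :=
  (Real.contDiffAt_rpow_const_of_ne hx.ne').mul
    ((contDiffAt_const.div contDiffAt_id hx.ne').exp)

lemma tendsto_dcheWeight (c : ℝ) {d : ℝ} (hd : 0 < d) :
    Tendsto (dcheWeight c d) (𝓝[>] 0) (𝓝 0) := by
  have h := (tendsto_rpow_mul_exp_neg_mul_atTop_nhds_zero (-c) d hd).comp
    (tendsto_inv_nhdsGT_zero (𝕜 := ℝ))
  refine h.congr' ?_
  filter_upwards [self_mem_nhdsWithin] with x hx
  have hx : 0 < x := hx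
  simp only [Function.comp, dcheWeight]
  rw [Real.inv_rpow hx.le, Real.rpow_neg hx.le, inv_inv]
  congr 2

lemma dcheWeight_mul_dcheWeight (c d c' d' : ℝ) {x : ℝ} (hx : 0 < x) :
    dcheWeight c d x * dcheWeight c' d' x = dcheWeight (c + c') (d + d') x := by
  unfold dcheWeight
  rw [Real.rpow_add hx, show -(d + d') / x = -d / x + -d' / x by ring, Real.exp_add]
  ring

lemma eventually_abs_lt_of_tendsto_zero {α : Type*} {f : α → ℝ} {l : Filter α}
    (h : Tendsto f l (𝓝 0)) {ε : ℝ} (hε : 0 < ε) : ∀ᶠ x in l, |f x| < ε :=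
  NormedAddGroup.tendsto_nhds_zero.1 h ε hε

/-- A function on `(0, x]` with nonnegative derivative that does not stay below a negative constant
near `0` is nonnegative at `x`. -/
lemma nonneg_of_deriv_nonneg {h h' : ℝ → ℝ} {x : ℝ} (hx : 0 < x)
    (hd : ∀ s ∈ Set.Ioc 0 x, HasDerivAt h (h' s) s) (h0 : ∀ s ∈ Set.Ioc 0 x, 0 ≤ h' s)
    (hf : ∀ ε > 0, ∃ᶠ s in 𝓝[>] (0 : ℝ), -ε < h s) : 0 ≤ h x := by
  have hmono : MonotoneOn h (Set.Ioc 0 x) := by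
    refine monotoneOn_of_deriv_nonneg (convex_Ioc 0 x)
      (fun s hs => (hd s hs).continuousAt.continuousWithinAt)
      (fun s hs => (hd s (interior_subset hs)).differentiableAt.differentiableWithinAt)
      (fun s hs => ?_)
    rw [(hd s (interior_subset hs)).deriv]
    exact h0 s (interior_subset hs)
  by_contra! hneg
  obtain ⟨s, hs1, hs2⟩ := ((hf (-h x) (by linarith)).and_eventually
    (Ioc_mem_nhdsGT hx)).exists
  have := hmono hs2 ⟨hx, le_rfl⟩ hs2.2
  linarith

/-- Integration of a bound `|f'| ≤ C * s ^ n` from the singular endpoint. -/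
lemma abs_le_of_abs_deriv_le {f f' : ℝ → ℝ} {C x : ℝ} (n : ℕ) (hx : 0 < x)
    (hd : ∀ s ∈ Set.Ioc 0 x, HasDerivAt f (f' s) s)
    (hb : ∀ s ∈ Set.Ioc 0 x, |f' s| ≤ C * s ^ n)
    (hf : Tendsto f (𝓝[>] 0) (𝓝 0)) : |f x| ≤ C * x ^ (n + 1) / (n + 1) := by
  have hpow : Tendsto (fun s : ℝ => C * s ^ (n + 1) / (n + 1)) (𝓝[>] 0) (𝓝 0) := by
    have : Continuous (fun s : ℝ => C * s ^ (n + 1) / (n + 1)) := by fun_prop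
    have h := (this.tendsto 0).mono_left (nhdsWithin_le_nhds (s := Set.Ioi 0))
    simpa using h
  have hpd : ∀ s : ℝ, HasDerivAt (fun s : ℝ => C * s ^ (n + 1) / (n + 1)) (C * s ^ n) s := by
    intro s
    have h1 : (n : ℝ) + 1 ≠ 0 := by positivity
    refine (((hasDerivAt_pow (n + 1) s).const_mul C).div_const ((n : ℝ) + 1)).congr_deriv ?_
    push_cast
    field_simp
  have key : ∀ g : ℝ → ℝ, Tendsto g (𝓝[>] 0) (𝓝 0) → ∀ ε > 0, ∃ᶠ s in 𝓝[>] (0 : ℝ), -ε < g s :=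
    fun g hg ε hε => (hg.eventually (lt_mem_nhds (neg_lt_zero.2 hε))).frequently
  rw [abs_le]
  constructor
  · have := nonneg_of_deriv_nonneg hx (fun s hs => (hpd s).add (hd s hs))
      (fun s hs => by linarith [(abs_le.1 (hb s hs)).1]) (key _ (by simpa using! hpow.add hf))
    simp only [Pi.add_apply] at this
    linarith
  · have := nonneg_of_deriv_nonneg hx (fun s hs => (hpd s).sub (hd s hs))
      (fun s hs => by linarith [(abs_le.1 (hb s hs)).2]) (key _ (by simpa using! hpow.sub hf))
    simp only [Pi.sub_apply] at this
    linarith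

/-- The lower half of `abs_le_of_first_order`: `weight * (v + comparison function)` is nondecreasing
and does not stay below a negative constant near `0`. -/
lemma neg_le_of_first_order {c d M x : ℝ} (hd : 0 < d) (hx : 0 < x) {v v' : ℝ → ℝ}
    (hv : ∀ s ∈ Set.Ioc 0 x, HasDerivAt v (v' s) s)
    (hb : ∀ s ∈ Set.Ioc 0 x, |s ^ 2 * v' s + (c * s + d) * v s| ≤ M)
    (hf : ∀ ε > 0, ∃ᶠ s in 𝓝[>] (0 : ℝ), |dcheWeight c d s * v s| < ε) :
    -(2 / d * Real.exp (c ^ 2 / (2 * d) * x) * M) ≤ v x := by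
  have hM : 0 ≤ M := (abs_nonneg _).trans (hb x ⟨hx, le_rfl⟩)
  -- The comparison function is `2 * M / d * exp (l * s)` with `l = c ^ 2 / (2 * d)`, for which
  -- `c * s + d + l * s ^ 2 ≥ d / 2` for every `s`.
  set l := c ^ 2 / (2 * d) with hl
  have hquad : ∀ s, d / 2 ≤ c * s + d + l * s ^ 2 := by
    intro s
    have : c * s + d + l * s ^ 2 - d / 2 = (c * s + d) ^ 2 / (2 * d) := by
      rw [hl]; field_simp; ring
    have h2 : 0 ≤ (c * s + d) ^ 2 / (2 * d) := by positivity
    linarith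
  have hE : ∀ s, HasDerivAt (fun s => 2 * M / d * Real.exp (l * s))
      (2 * M / d * (Real.exp (l * s) * l)) s := by
    intro s
    simpa using (((hasDerivAt_id s).const_mul l).exp).const_mul (2 * M / d)
  have h := nonneg_of_deriv_nonneg hx
    (fun s hs => (hasDerivAt_dcheWeight c d hs.1).mul ((hv s hs).add (hE s))) ?_ ?_
  · simp only [Pi.mul_apply, Pi.add_apply] at h
    have := nonneg_of_mul_nonneg_right h (dcheWeight_pos c d hx)
    have e : 2 / d * Real.exp (l * x) * M = 2 * M / d * Real.exp (l * x) := by ring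
    rw [e]; linarith
  · intro s hs
    have hw := dcheWeight_pos c d hs.1
    have hs0 := hs.1
    have e : dcheWeight c d s * ((c * s + d) / s ^ 2) * (v + fun s => 2 * M / d * Real.exp (l * s)) s
        + dcheWeight c d s * (v' s + 2 * M / d * (Real.exp (l * s) * l)) =
        dcheWeight c d s / s ^ 2 * ((s ^ 2 * v' s + (c * s + d) * v s) +
          2 * M / d * Real.exp (l * s) * (c * s + d + l * s ^ 2)) := by
      simp only [Pi.add_apply]; field_simp; ring
    rw [e]
    refine mul_nonneg (by positivity) ?_
    have h1 := (abs_le.1 (hb s hs)).1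
    have h2 : 1 ≤ Real.exp (l * s) := Real.one_le_exp (by positivity)
    have h3 : 2 * M / d * 1 * (d / 2) ≤ 2 * M / d * Real.exp (l * s) * (c * s + d + l * s ^ 2) :=
      mul_le_mul (mul_le_mul_of_nonneg_left h2 (by positivity)) (hquad s) (by positivity)
        (by positivity)
    have h4 : 2 * M / d * 1 * (d / 2) = M := by field_simp
    linarith
  · intro ε hε
    refine (hf ε hε).mp ?_
    filter_upwards [self_mem_nhdsWithin] with s hs h1
    have h2 := (abs_lt.1 h1).1
    have h3 : 0 ≤ dcheWeight c d s * (2 * M / d * Real.exp (l * s)) :=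
      mul_nonneg (dcheWeight_pos c d hs).le (by positivity)
    simp only [Pi.mul_apply, Pi.add_apply]
    linarith

/-- The solutions of `x ^ 2 * v' + (c * x + d) * v = G` other than the one that is bounded at `0`
blow up like the inverse of the integrating factor; if `weight * v` takes arbitrarily small values
near `0`, then `v` is controlled by the sup norm of `G`. -/
lemma abs_le_of_first_order {c d M x : ℝ} (hd : 0 < d) (hx : 0 < x) {v v' : ℝ → ℝ}
    (hv : ∀ s ∈ Set.Ioc 0 x, HasDerivAt v (v' s) s)
    (hb : ∀ s ∈ Set.Ioc 0 x, |s ^ 2 * v' s + (c * s + d) * v s| ≤ M)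
    (hf : ∀ ε > 0, ∃ᶠ s in 𝓝[>] (0 : ℝ), |dcheWeight c d s * v s| < ε) :
    |v x| ≤ 2 / d * Real.exp (c ^ 2 / (2 * d) * x) * M := by
  rw [abs_le]
  refine ⟨neg_le_of_first_order hd hx hv hb hf, ?_⟩
  have := neg_le_of_first_order (v := fun s => -v s) (v' := fun s => -v' s) (M := M) (c := c) hd hx
    (fun s hs => (hv s hs).neg)
    (fun s hs => by
      rw [← abs_neg]; convert hb s hs using 2; ring)
    (fun ε hε => by simpa [abs_neg] using hf ε hε)
  linarith

/-! ### Successive approximation -/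

lemma exists_antideriv {h : ℝ → ℝ} (hc : ContinuousOn h (Set.Ioi 0))
    (hb : ∀ R > 0, ∃ M, ∀ s ∈ Set.Ioc 0 R, |h s| ≤ M) :
    ∃ H : ℝ → ℝ, (∀ x > 0, HasDerivAt H (h x) x) ∧ Tendsto H (𝓝[>] 0) (𝓝 0) := by
  have hint : ∀ R > 0, IntervalIntegrable h MeasureTheory.volume 0 R := by
    intro R hR
    obtain ⟨M, hM⟩ := hb R hR
    rw [intervalIntegrable_iff_integrableOn_Ioc_of_le hR.le]
    refine MeasureTheory.IntegrableOn.of_bound (by simp)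
      ((hc.mono Set.Ioc_subset_Ioi_self).aestronglyMeasurable measurableSet_Ioc) M ?_
    exact (MeasureTheory.ae_restrict_iff' measurableSet_Ioc).2 (Eventually.of_forall hM)
  refine ⟨fun x => ∫ s in (0 : ℝ)..x, h s, fun x hx => ?_, ?_⟩
  · exact intervalIntegral.integral_hasDerivAt_right (hint x hx)
      (hc.stronglyMeasurableAtFilter isOpen_Ioi x hx) (hc.continuousAt (Ioi_mem_nhds hx))
  · obtain ⟨M, hM⟩ := hb 1 one_pos
    have h0 : Tendsto (fun x : ℝ => M * |x - 0|) (𝓝[>] 0) (𝓝 0) := by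
      have : Continuous (fun x : ℝ => M * |x - 0|) := by fun_prop
      simpa using (this.tendsto 0).mono_left (nhdsWithin_le_nhds (s := Set.Ioi 0))
    refine squeeze_zero_norm' ?_ h0
    filter_upwards [Ioc_mem_nhdsGT (zero_lt_one (α := ℝ))] with x hx
    refine intervalIntegral.norm_integral_le_of_norm_le_const fun s hs => ?_
    rw [Set.uIoc_of_le hx.1.le] at hs
    exact hM s ⟨hs.1, hs.2.trans hx.2⟩

/-- One step of successive approximation: with the right-hand side `(a * x + b) * f` frozen, the
equation has a solution `F`, with derivative `v`, that vanishes at `0` and has one more power of `x`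
than `f`. -/
lemma exists_approx_step (a b c : ℝ) {d : ℝ} (hd : 0 < d) {f : ℝ → ℝ}
    (hc : ContinuousOn f (Set.Ioi 0)) (hb : ∀ R > 0, ∃ M, ∀ s ∈ Set.Ioc 0 R, |f s| ≤ M) :
    ∃ F v : ℝ → ℝ, (∀ x > 0, HasDerivAt F (v x) x) ∧
      (∀ x > 0, HasDerivAt v (((a * x + b) * f x - (c * x + d) * v x) / x ^ 2) x) ∧
      Tendsto F (𝓝[>] 0) (𝓝 0) ∧
      (∀ (R M : ℝ) (n : ℕ), (∀ x ∈ Set.Ioc 0 R, |f x| ≤ M * x ^ n) → ∀ x ∈ Set.Ioc 0 R,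
        |v x| ≤ 2 / d * Real.exp (c ^ 2 / (2 * d) * R) * (|a| * R + |b|) * M * x ^ n ∧
        |F x| ≤ 2 / d * Real.exp (c ^ 2 / (2 * d) * R) * (|a| * R + |b|) * M
          * x ^ (n + 1) / (n + 1)) := by
  have hwb : ∀ R > 0, ∃ M, ∀ s ∈ Set.Ioc 0 R, |dcheWeight (c - 2) d s| ≤ M := by
    intro R hR
    obtain ⟨δ, hδ, h1⟩ := mem_nhdsGT_iff_exists_Ioo_subset.1
      (eventually_abs_lt_of_tendsto_zero (tendsto_dcheWeight (c - 2) hd) one_pos)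
    have hδ : 0 < δ := hδ
    obtain ⟨B, hB⟩ := (isCompact_Icc (a := δ / 2) (b := R)).exists_bound_of_continuousOn
      (f := dcheWeight (c - 2) d) fun s hs =>
        (hasDerivAt_dcheWeight (c - 2) d (by linarith [hs.1])).continuousAt.continuousWithinAt
    refine ⟨max 1 B, fun s hs => ?_⟩
    rcases lt_or_ge s (δ / 2) with h | h
    · exact le_max_of_le_left (le_of_lt (h1 ⟨hs.1, by linarith⟩))
    · exact le_max_of_le_right (hB s ⟨h, hs.2⟩)
  obtain ⟨G, hG, hG0⟩ := exists_antideriv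
    (h := fun s => dcheWeight (c - 2) d s * ((a * s + b) * f s))
    (ContinuousOn.mul
      (fun s hs => (hasDerivAt_dcheWeight (c - 2) d hs).continuousAt.continuousWithinAt)
      (ContinuousOn.mul (by fun_prop) hc))
    (fun R hR => by
      obtain ⟨M1, h1⟩ := hwb R hR
      obtain ⟨M2, h2⟩ := hb R hR
      refine ⟨M1 * ((|a| * R + |b|) * M2), fun s hs => ?_⟩
      have hM1 := (abs_nonneg _).trans (h1 s hs)
      have hM2 := (abs_nonneg _).trans (h2 s hs)
      rw [abs_mul, abs_mul]
      have h3 : |a * s + b| ≤ |a| * R + |b| := by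
        refine (abs_add_le _ _).trans ?_
        rw [abs_mul, abs_of_pos hs.1]
        gcongr; exact hs.2
      exact mul_le_mul (h1 s hs) (mul_le_mul h3 (h2 s hs) (abs_nonneg _) (by positivity))
        (by positivity) hM1)
  -- `weight * v` is the integral of `weight * (a * x + b) * f / x ^ 2` from `0`; in particular it
  -- tends to `0`, which makes `v` the derivative that stays bounded at `0`.
  set v : ℝ → ℝ := fun x => G x / dcheWeight c d x with hvdef
  have hv : ∀ x > 0, HasDerivAt v (((a * x + b) * f x - (c * x + d) * v x) / x ^ 2) x := by
    intro x hx
    have hw := dcheWeight_pos c d hx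
    refine ((hG x hx).div (hasDerivAt_dcheWeight c d hx) hw.ne').congr_deriv ?_
    have e : dcheWeight (c - 2) d x = dcheWeight c d x / x ^ 2 := by
      unfold dcheWeight
      rw [Real.rpow_sub hx, Real.rpow_two]; ring
    rw [e, hvdef]
    field_simp
  have hvb : ∀ (R M : ℝ) (n : ℕ), (∀ x ∈ Set.Ioc 0 R, |f x| ≤ M * x ^ n) → ∀ x ∈ Set.Ioc 0 R,
      |v x| ≤ 2 / d * Real.exp (c ^ 2 / (2 * d) * R) * (|a| * R + |b|) * M * x ^ n := by
    intro R M n hf x hx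
    have hx0 := hx.1
    have hR : 0 < R := hx.1.trans_le hx.2
    have hM : 0 ≤ M * x ^ n := (abs_nonneg _).trans (hf x hx)
    have hM' : 0 ≤ M := nonneg_of_mul_nonneg_left hM (pow_pos hx0 n)
    refine (abs_le_of_first_order (c := c) (M := (|a| * R + |b|) * (M * x ^ n)) hd hx0
      (fun s hs => hv s hs.1) (fun s hs => ?_) (fun ε hε => ?_)).trans ?_
    · have hs0 := hs.1
      have e : s ^ 2 * (((a * s + b) * f s - (c * s + d) * v s) / s ^ 2) + (c * s + d) * v s
          = (a * s + b) * f s := by field_simp; ring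
      rw [e, abs_mul]
      have h3 : |a * s + b| ≤ |a| * R + |b| := by
        refine (abs_add_le _ _).trans ?_
        rw [abs_mul, abs_of_pos hs.1]
        gcongr; exact hs.2.trans hx.2
      refine mul_le_mul h3 ((hf s ⟨hs.1, hs.2.trans hx.2⟩).trans ?_) (abs_nonneg _) (by positivity)
      gcongr; exact hs.2
    · have h1 := eventually_abs_lt_of_tendsto_zero hG0 hε
      refine Eventually.frequently ?_
      filter_upwards [h1, self_mem_nhdsWithin] with s h2 hs
      rwa [hvdef, mul_div_cancel₀ _ (dcheWeight_pos c d hs).ne']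
    · have : Real.exp (c ^ 2 / (2 * d) * x) ≤ Real.exp (c ^ 2 / (2 * d) * R) := by
        gcongr; exact hx.2
      calc _ ≤ 2 / d * Real.exp (c ^ 2 / (2 * d) * R) * ((|a| * R + |b|) * (M * x ^ n)) := by
            gcongr
        _ = _ := by ring
  obtain ⟨F, hF, hF0⟩ := exists_antideriv (h := v)
    (fun x hx => (hv x hx).continuousAt.continuousWithinAt)
    (fun R hR => by
      obtain ⟨M, hM⟩ := hb R hR
      refine ⟨2 / d * Real.exp (c ^ 2 / (2 * d) * R) * (|a| * R + |b|) * M, fun s hs => ?_⟩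
      simpa only [pow_zero, mul_one] using hvb R M 0 (by simpa using hM) s hs)
  refine ⟨F, v, hF, hv, hF0, fun R M n hf x hx => ⟨hvb R M n hf x hx, ?_⟩⟩
  exact abs_le_of_abs_deriv_le n hx.1 (fun s hs => hF s hs.1)
    (fun s hs => hvb R M n hf s ⟨hs.1, hs.2.trans hx.2⟩) hF0

/-- The successive approximations `u n`, with `v n` the derivative of `u (n + 1)`; their bounds are
those of an exponential series on every `(0, R]`. -/
lemma exists_approx_seq (a b c : ℝ) {d : ℝ} (hd : 0 < d) :
    ∃ u v : ℕ → ℝ → ℝ, (∀ x, u 0 x = 1) ∧ (∀ n, ∀ x > 0, HasDerivAt (u (n + 1)) (v n x) x) ∧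
      (∀ n, ∀ x > 0, HasDerivAt (v n) (((a * x + b) * u n x - (c * x + d) * v n x) / x ^ 2) x) ∧
      (∀ n, Tendsto (u (n + 1)) (𝓝[>] 0) (𝓝 0)) ∧
      (∀ R > 0, ∃ K ≥ 0, ∀ n, ∀ x ∈ Set.Ioc 0 R,
        |u n x| ≤ (K * R) ^ n / n.factorial ∧ |v n x| ≤ K * ((K * R) ^ n / n.factorial)) := by
  let S := {f : ℝ → ℝ // ContinuousOn f (Set.Ioi 0) ∧ ∀ R > 0, ∃ M, ∀ s ∈ Set.Ioc 0 R, |f s| ≤ M}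
  choose F v h1 h2 h3 h4 using fun f : S => exists_approx_step a b c hd f.2.1 f.2.2
  have good : ∀ f : S, ContinuousOn (F f) (Set.Ioi 0) ∧
      ∀ R > 0, ∃ M, ∀ s ∈ Set.Ioc 0 R, |F f s| ≤ M := by
    refine fun f => ⟨fun x hx => (h1 f x hx).continuousAt.continuousWithinAt, fun R hR => ?_⟩
    obtain ⟨M, hM⟩ := f.2.2 R hR
    refine ⟨2 / d * Real.exp (c ^ 2 / (2 * d) * R) * (|a| * R + |b|) * M * R, fun s hs => ?_⟩
    have hM0 : 0 ≤ M := (abs_nonneg _).trans (hM s hs)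
    have := (h4 f R M 0 (by simpa using hM) s hs).2
    simp only [zero_add, pow_one, Nat.cast_zero, div_one] at this
    refine this.trans ?_
    gcongr
    exact hs.2
  let u : ℕ → S := fun n => Nat.rec
    ⟨fun _ => 1, continuousOn_const, fun R _ => ⟨1, fun s _ => by simp⟩⟩
    (fun _ f => ⟨F f, good f⟩) n
  have hu : ∀ n, (u (n + 1)).1 = F (u n) := fun n => rfl
  have hu0 : ∀ x, (u 0).1 x = 1 := fun x => rfl
  refine ⟨fun n => (u n).1, fun n => v (u n), hu0, fun n => h1 (u n), fun n => h2 (u n),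
    fun n => h3 (u n), fun R hR => ?_⟩
  set K := 2 / d * Real.exp (c ^ 2 / (2 * d) * R) * (|a| * R + |b|) with hK
  have hK0 : 0 ≤ K := by positivity
  clear_value K
  have hb : ∀ n, ∀ x ∈ Set.Ioc 0 R, |(u n).1 x| ≤ K ^ n / n.factorial * x ^ n := by
    intro n
    induction n with
    | zero => intro x hx; simp [hu0]
    | succ n ih =>
      intro x hx
      rw [hu]
      refine (h4 (u n) R _ n ih x hx).2.trans (le_of_eq ?_)
      rw [← hK, Nat.factorial_succ]
      push_cast
      field_simp
      ring
  refine ⟨K, hK0, fun n x hx => ?_⟩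
  have hx0 := hx.1
  have hpow : K ^ n / n.factorial * x ^ n ≤ (K * R) ^ n / n.factorial := by
    rw [mul_pow, div_mul_eq_mul_div]
    gcongr
    exact hx.2
  refine ⟨(hb n x hx).trans hpow, (h4 (u n) R _ n (hb n) x hx).1.trans ?_⟩
  rw [← hK, mul_assoc]
  exact mul_le_mul_of_nonneg_left hpow hK0

/-- Existence of the solution that tends to `1` at `0`, with bounded derivative, as the sum of the
successive approximations. -/
lemma exists_solution (a b c : ℝ) {d : ℝ} (hd : 0 < d) :
    ∃ y v : ℝ → ℝ, (∀ x > 0, HasDerivAt y (v x) x) ∧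
      (∀ x > 0, HasDerivAt v (((a * x + b) * y x - (c * x + d) * v x) / x ^ 2) x) ∧
      Tendsto y (𝓝[>] 0) (𝓝 1) ∧ v =O[𝓝[>] 0] (fun _ => (1 : ℝ)) := by
  obtain ⟨u, v, hu0, hu, hv, hlim, hbd⟩ := exists_approx_seq a b c hd
  choose! K hK0 hK using hbd
  have hexp : ∀ t : ℝ, Summable fun n : ℕ => t ^ n / n.factorial := Real.summable_pow_div_factorial
  have hsu : ∀ R > 0, Summable fun n : ℕ => (K R * R) ^ (n + 1) / (n + 1).factorial :=
    fun R _ => (summable_nat_add_iff 1).2 (hexp (K R * R))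
  have hsum_u : ∀ x > 0, Summable fun n => u n x := fun x hx =>
    Summable.of_norm_bounded (hexp (K x * x)) fun n => (hK x hx n x ⟨hx, le_rfl⟩).1
  have hsum_u' : ∀ x > 0, Summable fun n => u (n + 1) x := fun x hx =>
    (summable_nat_add_iff 1).2 (hsum_u x hx)
  have hsum_v : ∀ x > 0, Summable fun n => v n x := fun x hx =>
    Summable.of_norm_bounded ((hexp (K x * x)).mul_left (K x))
      fun n => (hK x hx n x ⟨hx, le_rfl⟩).2
  refine ⟨fun x => 1 + ∑' n, u (n + 1) x, fun x => ∑' n, v n x, fun x hx => ?_, fun x hx => ?_,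
    ?_, ?_⟩
  · have hR : 0 < x + 1 := by linarith
    refine HasDerivAt.const_add 1 (hasDerivAt_tsum_of_isPreconnected
      ((hexp (K (x + 1) * (x + 1))).mul_left (K (x + 1))) (isOpen_Ioo (a := 0) (b := x + 1))
      isPreconnected_Ioo (fun n s hs => hu n s hs.1)
      (fun n s hs => (hK (x + 1) hR n s ⟨hs.1, hs.2.le⟩).2)
      (y₀ := x) ⟨hx, by linarith⟩ (hsum_u' x hx) ⟨hx, by linarith⟩)
  · have hR : 0 < x + 1 := by linarith
    set R := x + 1 with hRdef
    have key := hasDerivAt_tsum_of_isPreconnected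
      (u := fun n : ℕ => ((|a| * R + |b|) * ((K R * R) ^ n / n.factorial) +
        (|c| * R + |d|) * (K R * ((K R * R) ^ n / n.factorial))) / (x / 2) ^ 2)
      (((hexp (K R * R)).mul_left _).add (((hexp (K R * R)).mul_left _).mul_left _) |>.div_const _)
      (isOpen_Ioo (a := x / 2) (b := R))
      isPreconnected_Ioo (fun n s hs => hv n s ((half_pos hx).trans hs.1))
      (fun n s hs => ?_)
      (y₀ := x) (y := x) ⟨half_lt_self hx, by linarith⟩ (hsum_v x hx) ⟨half_lt_self hx, by linarith⟩
    · refine key.congr_deriv ?_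
      rw [tsum_div_const, Summable.tsum_sub ((hsum_u x hx).mul_left _) ((hsum_v x hx).mul_left _),
        tsum_mul_left, tsum_mul_left, (hsum_u x hx).tsum_eq_zero_add, hu0]
    · have hs0 : 0 < s := by linarith [hs.1]
      obtain ⟨hb1, hb2⟩ := hK R hR n s ⟨hs0, hs.2.le⟩
      have h3 : ∀ p q : ℝ, |p * s + q| ≤ |p| * R + |q| := fun p q => by
        refine (abs_add_le _ _).trans ?_
        rw [abs_mul, abs_of_pos hs0]
        gcongr; exact hs.2.le
      rw [Real.norm_eq_abs, abs_div, abs_of_pos (pow_pos hs0 2)]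
      refine div_le_div₀ (by have := hK0 R hR; positivity) ((abs_sub _ _).trans ?_) (by positivity)
        (by gcongr; exact hs.1.le)
      rw [abs_mul, abs_mul]
      exact add_le_add (mul_le_mul (h3 a b) hb1 (abs_nonneg _) (by positivity))
        (mul_le_mul (h3 c d) hb2 (abs_nonneg _) (by positivity))
  · have : Tendsto (fun x => ∑' n, u (n + 1) x) (𝓝[>] 0) (𝓝 (∑' _ : ℕ, (0 : ℝ))) := by
      refine tendsto_tsum_of_dominated_convergence (hsu 1 one_pos) (fun n => hlim n) ?_
      filter_upwards [Ioc_mem_nhdsGT (zero_lt_one (α := ℝ))] with x hx n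
      exact (hK 1 one_pos (n + 1) x hx).1
    simpa using this.const_add 1
  · refine IsBigO.of_bound (∑' n : ℕ, K 1 * ((K 1 * 1) ^ n / n.factorial)) ?_
    filter_upwards [Ioc_mem_nhdsGT (zero_lt_one (α := ℝ))] with x hx
    rw [norm_one, mul_one]
    exact tsum_of_norm_bounded ((hexp (K 1 * 1)).mul_left (K 1)).hasSum
      fun n => (hK 1 one_pos n x hx).2

/-! ### Uniqueness -/

/-- A solution that is `O(x)` at `0` vanishes.  By the mean value theorem on `[x, 2 * x]` its
derivative is bounded along a sequence tending to `0`, so that the first-order comparison applies;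
iterating it gives bounds `M * (K * x) ^ n / n!` for every `n`. -/
lemma solution_eq_zero {a b c d : ℝ} (hd : 0 < d) {w v : ℝ → ℝ}
    (hw : ∀ x > 0, HasDerivAt w (v x) x)
    (hv : ∀ x > 0, HasDerivAt v (((a * x + b) * w x - (c * x + d) * v x) / x ^ 2) x)
    (hO : w =O[𝓝[>] 0] fun x => x) {x : ℝ} (hx : 0 < x) : w x = 0 := by
  have hid : Tendsto (fun x : ℝ => x) (𝓝[>] 0) (𝓝 0) := tendsto_id.mono_left nhdsWithin_le_nhds
  have hw0 : Tendsto w (𝓝[>] 0) (𝓝 0) := hO.trans_tendsto hid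
  have hcluster : ∀ ε > 0, ∃ᶠ s in 𝓝[>] (0 : ℝ), |dcheWeight c d s * v s| < ε := by
    intro ε hε
    obtain ⟨C, hC, hOC⟩ := hO.exists_pos
    have hfreq : ∃ᶠ s in 𝓝[>] (0 : ℝ), |v s| ≤ 3 * C := by
      rw [frequently_iff]
      intro U hU
      obtain ⟨δ, hδ, h1⟩ := mem_nhdsGT_iff_exists_Ioo_subset.1 (inter_mem hU hOC.bound)
      have hδ : 0 < δ := hδ
      obtain ⟨ξ, hξ, hslope⟩ := exists_hasDerivAt_eq_slope w v (a := δ / 3) (b := 2 * (δ / 3))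
        (by linarith)
        (fun s hs => (hw s (by linarith [hs.1])).continuousAt.continuousWithinAt)
        (fun s hs => hw s (by linarith [hs.1]))
      refine ⟨ξ, (h1 ⟨by linarith [hξ.1], by linarith [hξ.2]⟩).1, ?_⟩
      have e1 : ‖w (δ / 3)‖ ≤ C * ‖δ / 3‖ := (h1 ⟨by linarith, by linarith⟩).2
      have e2 : ‖w (2 * (δ / 3))‖ ≤ C * ‖2 * (δ / 3)‖ := (h1 ⟨by linarith, by linarith⟩).2
      rw [Real.norm_eq_abs, Real.norm_eq_abs, abs_of_pos (a := δ / 3) (by linarith)] at e1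
      rw [Real.norm_eq_abs, Real.norm_eq_abs, abs_of_pos (a := 2 * (δ / 3)) (by linarith)] at e2
      rw [hslope, abs_div, abs_of_pos (a := 2 * (δ / 3) - δ / 3) (by linarith),
        div_le_iff₀ (by linarith)]
      refine (abs_sub _ _).trans ?_
      linarith
    refine (hfreq.and_eventually ((eventually_abs_lt_of_tendsto_zero (tendsto_dcheWeight c hd)
      (ε := ε / (3 * C)) (by positivity)))).mono ?_
    rintro s ⟨h1, h2⟩
    rw [abs_mul]
    calc |dcheWeight c d s| * |v s| ≤ |dcheWeight c d s| * (3 * C) := by gcongr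
      _ < ε / (3 * C) * (3 * C) := by gcongr
      _ = ε := by field_simp
  obtain ⟨M, hM⟩ : ∃ M, ∀ s ∈ Set.Ioc 0 x, |w s| ≤ M := by
    obtain ⟨δ, hδ, h1⟩ := mem_nhdsGT_iff_exists_Ioo_subset.1
      (eventually_abs_lt_of_tendsto_zero hw0 one_pos)
    have hδ : 0 < δ := hδ
    obtain ⟨B, hB⟩ := (isCompact_Icc (a := δ / 2) (b := x)).exists_bound_of_continuousOn
      (f := w) fun s hs => (hw s (by linarith [hs.1])).continuousAt.continuousWithinAt
    refine ⟨max 1 B, fun s hs => ?_⟩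
    rcases lt_or_ge s (δ / 2) with h | h
    · exact le_max_of_le_left (le_of_lt (h1 ⟨hs.1, by linarith⟩))
    · exact le_max_of_le_right (hB s ⟨h, hs.2⟩)
  have hM0 : 0 ≤ M := (abs_nonneg _).trans (hM x ⟨hx, le_rfl⟩)
  set K := 2 / d * Real.exp (c ^ 2 / (2 * d) * x) * (|a| * x + |b|) with hK
  have hK0 : 0 ≤ K := by positivity
  clear_value K
  have hb : ∀ n : ℕ, ∀ s ∈ Set.Ioc 0 x, |w s| ≤ M * K ^ n / n.factorial * s ^ n := by
    intro n
    induction n with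
    | zero => simpa using hM
    | succ n ih =>
      have hvb : ∀ t ∈ Set.Ioc 0 x, |v t| ≤ K * (M * K ^ n / n.factorial) * t ^ n := by
        intro t ht
        have ht0 := ht.1
        refine (abs_le_of_first_order (c := c)
          (M := (|a| * x + |b|) * (M * K ^ n / n.factorial * t ^ n)) hd ht0
          (fun s hs => hv s hs.1) (fun s hs => ?_) hcluster).trans ?_
        · have hs0 := hs.1
          have e : s ^ 2 * (((a * s + b) * w s - (c * s + d) * v s) / s ^ 2) + (c * s + d) * v s
              = (a * s + b) * w s := by field_simp; ring
          rw [e, abs_mul]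
          have h3 : |a * s + b| ≤ |a| * x + |b| := by
            refine (abs_add_le _ _).trans ?_
            rw [abs_mul, abs_of_pos hs.1]
            gcongr; exact hs.2.trans ht.2
          refine mul_le_mul h3 ((ih s ⟨hs.1, hs.2.trans ht.2⟩).trans ?_) (abs_nonneg _)
            (by positivity)
          gcongr; exact hs.2
        · have : Real.exp (c ^ 2 / (2 * d) * t) ≤ Real.exp (c ^ 2 / (2 * d) * x) := by
            gcongr; exact ht.2
          have hKn : 0 ≤ K ^ n := by positivity
          calc _ ≤ 2 / d * Real.exp (c ^ 2 / (2 * d) * x)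
                * ((|a| * x + |b|) * (M * K ^ n / n.factorial * t ^ n)) := by gcongr
            _ = _ := by rw [hK]; ring
      intro s hs
      refine (abs_le_of_abs_deriv_le n hs.1 (fun t ht => hw t ht.1)
        (fun t ht => hvb t ⟨ht.1, ht.2.trans hs.2⟩) hw0).trans (le_of_eq ?_)
      rw [Nat.factorial_succ]
      push_cast
      field_simp
      ring
  have hlim : Tendsto (fun n : ℕ => M * ((K * x) ^ n / n.factorial)) atTop (𝓝 0) := by
    simpa using (FloorSemiring.tendsto_pow_div_factorial_atTop (K * x)).const_mul M
  have : |w x| ≤ 0 := ge_of_tendsto' hlim fun n => by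
    refine (hb n x ⟨hx, le_rfl⟩).trans (le_of_eq ?_)
    rw [mul_pow]; ring
  exact abs_nonpos_iff.1 this

/-! ### Derivatives of all orders at the singular point -/

lemma hasDerivAt_iteratedDeriv {f : ℝ → ℝ} (hf : ContDiffOn ℝ ∞ f (Set.Ioi 0)) (m : ℕ) {x : ℝ}
    (hx : 0 < x) : HasDerivAt (iteratedDeriv m f) (iteratedDeriv (m + 1) f x) x := by
  have key : ContDiffOn ℝ ∞ (iteratedDeriv m f) (Set.Ioi 0) := by
    induction m with
    | zero => simpa using hf
    | succ m ih =>
      rw [iteratedDeriv_succ]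
      exact ((contDiffOn_infty_iff_deriv_of_isOpen isOpen_Ioi).1 ih).2
  rw [iteratedDeriv_succ]
  exact ((key.contDiffAt (Ioi_mem_nhds hx)).differentiableAt (by simp)).hasDerivAt

lemma isBigO_one_affine (p q : ℝ) : (fun x : ℝ => p * x + q) =O[𝓝[>] 0] fun _ => (1 : ℝ) :=
  ((show Continuous fun x : ℝ => p * x + q by fun_prop).tendsto 0 |>.mono_left
    nhdsWithin_le_nhds).isBigO_one ℝ

section Regularity

variable {a b c d : ℝ} {y v : ℝ → ℝ}

lemma contDiffOn_solution (hy : ∀ x > 0, HasDerivAt y (v x) x)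
    (hv : ∀ x > 0, HasDerivAt v (((a * x + b) * y x - (c * x + d) * v x) / x ^ 2) x) :
    ContDiffOn ℝ ∞ y (Set.Ioi 0) := by
  have key : ∀ n : ℕ, ContDiffOn ℝ n y (Set.Ioi 0) ∧ ContDiffOn ℝ n v (Set.Ioi 0) := by
    intro n
    induction n with
    | zero =>
      exact ⟨contDiffOn_zero.2 fun x hx => (hy x hx).continuousAt.continuousWithinAt,
        contDiffOn_zero.2 fun x hx => (hv x hx).continuousAt.continuousWithinAt⟩
    | succ n ih =>
      push_cast
      rw [contDiffOn_succ_iff_deriv_of_isOpen isOpen_Ioi,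
        contDiffOn_succ_iff_deriv_of_isOpen isOpen_Ioi]
      refine ⟨⟨fun x hx => (hy x hx).differentiableAt.differentiableWithinAt, by simp,
        ih.2.congr fun x hx => (hy x hx).deriv⟩,
        fun x hx => (hv x hx).differentiableAt.differentiableWithinAt, by simp,
        ContDiffOn.congr ?_ fun x hx => (hv x hx).deriv⟩
      refine ContDiffOn.div ?_ (by fun_prop) fun x hx => pow_ne_zero 2 (ne_of_gt hx)
      exact (ContDiffOn.mul (by fun_prop) ih.1).sub (ContDiffOn.mul (by fun_prop) ih.2)
  exact contDiffOn_infty.2 fun n => (key n).1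

/-- The `m`-fold differentiated equation: again of the same kind, with `c` replaced by
`c + 2 * m` and an additional term containing the derivative of order `m - 1` (the natural number
subtraction is harmless, since the factor `m` vanishes for `m = 0`). -/
lemma iteratedDeriv_equation (hs : ContDiffOn ℝ ∞ y (Set.Ioi 0))
    (heq : ∀ x > 0, x ^ 2 * iteratedDeriv 2 y x + (c * x + d) * iteratedDeriv 1 y x
      = (a * x + b) * y x) (m : ℕ) {x : ℝ} (hx : 0 < x) :
    x ^ 2 * iteratedDeriv (m + 2) y x + ((c + 2 * m) * x + d) * iteratedDeriv (m + 1) y x =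
      (a * x + (b - m * (m - 1 + c))) * iteratedDeriv m y x
        + m * a * iteratedDeriv (m - 1) y x := by
  induction m generalizing x with
  | zero => simpa using heq x hx
  | succ m ih =>
    have hD := fun i => hasDerivAt_iteratedDeriv hs i hx
    have h1 := ((hasDerivAt_pow 2 x).mul (hD (m + 2))).add
      ((((hasDerivAt_id x).const_mul (c + 2 * m)).add_const d).mul (hD (m + 1)))
    have h2 := ((((hasDerivAt_id x).const_mul a).add_const (b - m * (m - 1 + c))).mul (hD m)).add
      ((hD (m - 1)).const_mul ((m : ℝ) * a))
    have h3 := h1.unique (h2.congr_of_eventuallyEq (by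
      filter_upwards [Ioi_mem_nhds hx] with s hs
      simpa using! ih hs))
    have h4 : (m : ℝ) * a * iteratedDeriv (m - 1 + 1) y x = m * a * iteratedDeriv m y x := by
      rcases m with _ | m <;> simp
    simp only [h4, id] at h3
    push_cast
    linear_combination h3

/-- The a priori bound `w = O(x⁻²)` excludes the exponentially large solutions, since the
integrating factor is exponentially small. -/
lemma isBigO_one_of_first_order (hd : 0 < d) {w w' : ℝ → ℝ}
    (hw : ∀ x > 0, HasDerivAt w (w' x) x)
    (hG : (fun x => x ^ 2 * w' x + (c * x + d) * w x) =O[𝓝[>] 0] fun _ => (1 : ℝ))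
    (hw2 : (fun x => x ^ 2 * w x) =O[𝓝[>] 0] fun _ => (1 : ℝ)) :
    w =O[𝓝[>] 0] fun _ => (1 : ℝ) := by
  have hlim : Tendsto (fun s => dcheWeight c d s * w s) (𝓝[>] 0) (𝓝 0) := by
    have h := (isBigO_refl (dcheWeight (c - 2) d) (𝓝[>] 0)).mul hw2
    simp only [mul_one] at h
    refine (h.trans_tendsto (tendsto_dcheWeight (c - 2) hd)).congr' ?_
    filter_upwards [self_mem_nhdsWithin] with s hs
    have hs : 0 < s := hs
    unfold dcheWeight
    rw [Real.rpow_sub hs, Real.rpow_two]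
    field_simp
  obtain ⟨M, hM⟩ := hG.bound
  obtain ⟨δ, hδ, h1⟩ := mem_nhdsGT_iff_exists_Ioo_subset.1 hM
  have hδ : 0 < δ := hδ
  refine IsBigO.of_bound (2 / d * Real.exp (c ^ 2 / (2 * d) * δ) * M) ?_
  filter_upwards [Ioo_mem_nhdsGT hδ] with x hx
  have hM0 : 0 ≤ M := by
    have := (norm_nonneg _).trans (h1 hx)
    simpa using this
  refine (abs_le_of_first_order hd hx.1 (fun s hs => hw s hs.1) (M := M) (c := c)
    (fun s hs => by simpa using h1 ⟨hs.1, hs.2.trans_lt hx.2⟩)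
    (fun ε hε => (eventually_abs_lt_of_tendsto_zero hlim hε).frequently)).trans ?_
  rw [norm_one, mul_one]
  gcongr
  exact hx.2.le

/-- All derivatives of a solution that is bounded together with its first derivative are bounded
near `0`: `x ^ 2 * y^(m+2)` is bounded by the `m`-fold differentiated equation, and then the next
differentiated equation is a first-order equation for `y^(m+2)` with bounded right-hand side. -/
lemma iteratedDeriv_isBigO_one (hd : 0 < d) (hs : ContDiffOn ℝ ∞ y (Set.Ioi 0))
    (heq : ∀ x > 0, x ^ 2 * iteratedDeriv 2 y x + (c * x + d) * iteratedDeriv 1 y x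
      = (a * x + b) * y x)
    (h0 : iteratedDeriv 0 y =O[𝓝[>] 0] fun _ => (1 : ℝ))
    (h1 : iteratedDeriv 1 y =O[𝓝[>] 0] fun _ => (1 : ℝ)) (m : ℕ) :
    iteratedDeriv m y =O[𝓝[>] 0] fun _ => (1 : ℝ) := by
  have hmul : ∀ (p q : ℝ) {f : ℝ → ℝ}, f =O[𝓝[>] 0] (fun _ => (1 : ℝ)) →
      (fun x => (p * x + q) * f x) =O[𝓝[>] 0] fun _ => (1 : ℝ) := fun p q f hf => by
    simpa using (isBigO_one_affine p q).mul hf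
  have hpos : ∀ᶠ x in 𝓝[>] (0 : ℝ), 0 < x := self_mem_nhdsWithin
  induction m using Nat.strong_induction_on with
  | _ m ih =>
    rcases m with _ | _ | m
    · exact h0
    · exact h1
    have hm := ih m (by omega)
    have hm1 := ih (m + 1) (by omega)
    have hm0 := ih (m - 1) (by omega)
    refine isBigO_one_of_first_order (c := c + 2 * (m + 1 : ℕ)) hd
      (fun x hx => hasDerivAt_iteratedDeriv hs (m + 2) hx) ?_ ?_
    · refine ((hmul a (b - (m + 1 : ℕ) * ((m + 1 : ℕ) - 1 + c)) hm1).add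
        (hm.const_mul_left ((m + 1 : ℕ) * a))).congr' ?_ EventuallyEq.rfl
      filter_upwards [hpos] with x hx using (iteratedDeriv_equation hs heq (m + 1) hx).symm
    · refine (((hmul a (b - m * (m - 1 + c)) hm).add
        (hm0.const_mul_left (m * a))).sub (hmul (c + 2 * m) d hm1)).congr' ?_ EventuallyEq.rfl
      filter_upwards [hpos] with x hx
      rw [← iteratedDeriv_equation hs heq m hx]; ring

lemma recCoeff_succ_succ (p q : ℕ → ℝ) (k : ℕ) :
    recCoeff p q (k + 2) = p (k + 2) * recCoeff p q (k + 1) + q (k + 2) * recCoeff p q k := rfl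

/-- In the limit `x → 0` the differentiated equations become the recurrence for
`m! * coeffPos a b c d m`. -/
lemma tendsto_iteratedDeriv (hd : 0 < d) (hs : ContDiffOn ℝ ∞ y (Set.Ioi 0))
    (heq : ∀ x > 0, x ^ 2 * iteratedDeriv 2 y x + (c * x + d) * iteratedDeriv 1 y x
      = (a * x + b) * y x)
    (hy : Tendsto y (𝓝[>] 0) (𝓝 1))
    (hb : ∀ m, iteratedDeriv m y =O[𝓝[>] 0] fun _ => (1 : ℝ)) (m : ℕ) :
    Tendsto (iteratedDeriv m y) (𝓝[>] 0) (𝓝 (m.factorial * coeffPos a b c d m)) := by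
  have hid : Tendsto (fun x : ℝ => x) (𝓝[>] 0) (𝓝 0) := tendsto_id.mono_left nhdsWithin_le_nhds
  have hx1 : ∀ m, Tendsto (fun x => x * iteratedDeriv m y x) (𝓝[>] 0) (𝓝 0) := fun m => by
    have h := (isBigO_refl (fun x : ℝ => x) (𝓝[>] 0)).mul (hb m)
    simp only [mul_one] at h
    exact h.trans_tendsto hid
  have hx2 : ∀ m, Tendsto (fun x => x ^ 2 * iteratedDeriv m y x) (𝓝[>] 0) (𝓝 0) := fun m => by
    have h := hid.mul (hx1 m)
    simp only [mul_zero] at h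
    exact h.congr fun x => by ring
  have step : ∀ (m : ℕ) (L L' : ℝ), Tendsto (iteratedDeriv m y) (𝓝[>] 0) (𝓝 L) →
      Tendsto (fun x => m * a * iteratedDeriv (m - 1) y x) (𝓝[>] 0) (𝓝 L') →
      Tendsto (iteratedDeriv (m + 1) y) (𝓝[>] 0) (𝓝 (((b - m * (m - 1 + c)) * L + L') / d)) := by
    intro m L L' hL hL'
    have h := ((((hx1 m).const_mul a).add (hL.const_mul (b - m * (m - 1 + c)))).add hL').sub
      ((hx2 (m + 2)).add ((hx1 (m + 1)).const_mul (c + 2 * m))) |>.div_const d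
    simp only [mul_zero, zero_add, add_zero, sub_zero] at h
    refine h.congr' ?_
    filter_upwards [self_mem_nhdsWithin] with x hx
    have := iteratedDeriv_equation hs heq m hx
    rw [div_eq_iff hd.ne']
    linear_combination -this
  have h0 : Tendsto (iteratedDeriv 0 y) (𝓝[>] 0) (𝓝 1) := by simpa using hy
  induction m using Nat.strong_induction_on with
  | _ m ih =>
    rcases m with _ | _ | m
    · simpa [coeffPos, recCoeff] using h0
    · convert step 0 1 0 h0 (by simp) using 2
      simp [coeffPos, recCoeff]
    · convert step (m + 1) _ _ (ih (m + 1) (by omega))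
        ((ih m (by omega)).const_mul (((m + 1 : ℕ) : ℝ) * a)) using 2
      unfold coeffPos
      rw [recCoeff_succ_succ, Nat.factorial_succ (m + 1), Nat.factorial_succ m]
      push_cast
      field_simp
      ring

end Regularity

/-- Termwise differentiation follows from the limits of all derivatives by integrating downwards
from the derivative of order `n`, which is merely bounded. -/
lemma taylor_remainder_isBigO {D T : ℕ → ℝ → ℝ} (n : ℕ)
    (hD : ∀ m, ∀ x > 0, HasDerivAt (D m) (D (m + 1) x) x)
    (hT : ∀ m, ∀ x > 0, HasDerivAt (T m) (T (m + 1) x) x)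
    (hb : ∀ m, (fun x => D m x - T m x) =O[𝓝[>] 0] fun _ => (1 : ℝ))
    (h0 : ∀ m < n, Tendsto (fun x => D m x - T m x) (𝓝[>] 0) (𝓝 0)) (m : ℕ) :
    (fun x => D m x - T m x) =O[𝓝[>] 0] fun x => x ^ ((n : ℤ) - (m : ℤ)) := by
  rcases le_total n m with hnm | hnm
  · refine (hb m).trans (IsBigO.of_bound 1 ?_)
    filter_upwards [Ioc_mem_nhdsGT (zero_lt_one (α := ℝ))] with x hx
    rw [norm_one, one_mul, norm_zpow, Real.norm_of_nonneg hx.1.le]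
    exact one_le_zpow_of_nonpos₀ hx.1 hx.2 (by omega)
  · obtain ⟨j, rfl⟩ := Nat.exists_eq_add_of_le hnm
    suffices H : ∀ i m', m' + i = m + j →
        (fun x => D m' x - T m' x) =O[𝓝[>] 0] fun x => x ^ i by
      simpa using H j m rfl
    intro i
    induction i with
    | zero => intro m' _; simpa using hb m'
    | succ i ih =>
      intro m' hm'
      obtain ⟨C, hC⟩ := (ih (m' + 1) (by omega)).bound
      obtain ⟨δ, hδ, h1⟩ := mem_nhdsGT_iff_exists_Ioo_subset.1 hC
      refine IsBigO.of_bound (C / (i + 1)) ?_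
      filter_upwards [Ioo_mem_nhdsGT hδ] with x hx
      have := abs_le_of_abs_deriv_le (C := C) i hx.1
        (fun s hs => (hD m' s hs.1).sub (hT m' s hs.1))
        (fun s hs => by
          have h2 := h1 (show s ∈ Set.Ioo 0 δ from ⟨hs.1, hs.2.trans_lt hx.2⟩)
          simp only [Set.mem_ofPred_eq, norm_pow, Real.norm_eq_abs] at h2
          rwa [abs_of_pos hs.1] at h2)
        (h0 m' (by omega))
      rw [norm_pow, Real.norm_of_nonneg hx.1.le, Real.norm_eq_abs]
      refine this.trans (le_of_eq (by ring))

lemma tendsto_sum_iteratedDeriv_monomial (A : ℕ → ℝ) {m n : ℕ} (hmn : m < n) :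
    Tendsto (fun x => ∑ k ∈ Finset.range n, iteratedDeriv m (fun x : ℝ => A k * x ^ k) x)
      (𝓝[>] 0) (𝓝 (m.factorial * A m)) := by
  have hcont : Continuous fun x : ℝ =>
      ∑ k ∈ Finset.range n, iteratedDeriv m (fun x : ℝ => A k * x ^ k) x :=
    continuous_finsetSum _ fun k _ =>
      (contDiff_const.mul (contDiff_id.pow k) : ContDiff ℝ m _).continuous_iteratedDeriv' m
  have h := (hcont.tendsto 0).mono_left (nhdsWithin_le_nhds (s := Set.Ioi 0))
  convert h using 2
  simp only [iteratedDeriv_const_mul_field, iteratedDeriv_fun_pow_zero]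
  simp [hmn, mul_comm]

/-- A solution of the equation with `d > 0` that tends to `1` at `0` and has bounded derivative has
the asymptotic power series with coefficients `coeffPos`, to all orders of differentiation. -/
lemma termwiseDiffPos_of_solution {a b c d : ℝ} {y v : ℝ → ℝ} (hd : 0 < d)
    (hy : ∀ x > 0, HasDerivAt y (v x) x)
    (hv : ∀ x > 0, HasDerivAt v (((a * x + b) * y x - (c * x + d) * v x) / x ^ 2) x)
    (hy0 : Tendsto y (𝓝[>] 0) (𝓝 1)) (hv0 : v =O[𝓝[>] 0] fun _ => (1 : ℝ)) :
    TermwiseDiffPos (coeffPos a b c d) y := by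
  have hs := contDiffOn_solution hy hv
  have hD1 : ∀ x > 0, iteratedDeriv 1 y x = v x := fun x hx => by
    rw [iteratedDeriv_one, (hy x hx).deriv]
  have hD2 : ∀ x > 0, iteratedDeriv 2 y x = ((a * x + b) * y x - (c * x + d) * v x) / x ^ 2 :=
    fun x hx => by
      rw [iteratedDeriv_succ, ← (hv x hx).deriv]
      refine EventuallyEq.deriv_eq ?_
      filter_upwards [Ioi_mem_nhds hx] with s hs using hD1 s hs
  have heq : ∀ x > 0, x ^ 2 * iteratedDeriv 2 y x + (c * x + d) * iteratedDeriv 1 y x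
      = (a * x + b) * y x := fun x hx => by
    rw [hD1 x hx, hD2 x hx]; field_simp; ring
  have hb := iteratedDeriv_isBigO_one hd hs heq (by simpa using hy0.isBigO_one ℝ)
    (hv0.congr' (by filter_upwards [self_mem_nhdsWithin] with x hx using (hD1 x hx).symm)
      EventuallyEq.rfl)
  have hlim := tendsto_iteratedDeriv hd hs heq hy0 hb
  refine ⟨hs, fun m n => ?_⟩
  have hmon : ∀ k, ContDiff ℝ ∞ fun x : ℝ => coeffPos a b c d k * x ^ k := fun k => by fun_prop
  refine taylor_remainder_isBigO
    (T := fun m x => ∑ k ∈ Finset.range n, iteratedDeriv m (fun x => coeffPos a b c d k * x ^ k) x)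
    n (fun m x hx => hasDerivAt_iteratedDeriv hs m hx)
    (fun m x hx => HasDerivAt.fun_sum fun k _ =>
      hasDerivAt_iteratedDeriv (hmon k).contDiffOn m hx)
    (fun m => (hb m).sub ?_) (fun m hm => ?_) m
  · have hcont : Continuous fun x : ℝ =>
        ∑ k ∈ Finset.range n, iteratedDeriv m (fun x : ℝ => coeffPos a b c d k * x ^ k) x :=
      continuous_finsetSum _ fun k _ =>
        (hmon k).continuous_iteratedDeriv m (by exact_mod_cast le_top)
    exact ((hcont.tendsto 0).mono_left nhdsWithin_le_nhds).isBigO_one ℝ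
  · simpa using (hlim m).sub (tendsto_sum_iteratedDeriv_monomial (coeffPos a b c d) hm)

/-! ### Positivity and monotonicity -/

section Positivity

variable {a b c d L : ℝ} {y v : ℝ → ℝ}

lemma deriv_pos_of_solution_pos (ha : 0 < a) (hb : 0 ≤ b)
    (hv : ∀ x > 0, HasDerivAt v (((a * x + b) * y x - (c * x + d) * v x) / x ^ 2) x)
    (hL : 0 ≤ L) (hlim : Tendsto (fun x => dcheWeight c d x * v x) (𝓝[>] 0) (𝓝 L))
    {X : ℝ} (hX : ∀ s ∈ Set.Ioo 0 X, 0 < y s) {x : ℝ} (hx : x ∈ Set.Ioo 0 X) : 0 < v x := by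
  have hder : ∀ s > 0, HasDerivAt (fun x => dcheWeight c d x * v x)
      (dcheWeight c d s * ((a * s + b) * y s / s ^ 2)) s := fun s hs => by
    refine ((hasDerivAt_dcheWeight c d hs).mul (hv s hs)).congr_deriv ?_
    field_simp
    ring
  have hpos : ∀ s ∈ Set.Ioo 0 X, 0 < dcheWeight c d s * ((a * s + b) * y s / s ^ 2) :=
    fun s hs => by
      have h1 := hs.1
      have h2 := hX s hs
      have h3 := dcheWeight_pos c d h1
      positivity
  have hhalf : 0 ≤ dcheWeight c d (x / 2) * v (x / 2) :=
    nonneg_of_deriv_nonneg (h := fun x => dcheWeight c d x * v x) (half_pos hx.1)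
      (fun s hs => hder s hs.1) (fun s hs => (hpos s ⟨hs.1, by linarith [hs.2, hx.1, hx.2]⟩).le)
      fun ε hε => (hlim.eventually (lt_mem_nhds (show -ε < L by linarith))).frequently
  have hmono : StrictMonoOn (fun x => dcheWeight c d x * v x) (Set.Icc (x / 2) x) := by
    have h0 : ∀ s ∈ Set.Icc (x / 2) x, 0 < s := fun s hs => by linarith [hs.1, hx.1]
    refine strictMonoOn_of_deriv_pos (convex_Icc _ _)
      (fun s hs => (hder s (h0 s hs)).continuousAt.continuousWithinAt) fun s hs => ?_
    have hs := interior_subset hs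
    rw [(hder s (h0 s hs)).deriv]
    exact hpos s ⟨h0 s hs, hs.2.trans_lt hx.2⟩
  have hlt := hmono ⟨le_rfl, by linarith [hx.1]⟩ ⟨by linarith [hx.1], le_rfl⟩ (half_lt_self hx.1)
  exact pos_of_mul_pos_right (hhalf.trans_lt hlt) (dcheWeight_pos c d hx.1).le

/-- As long as `y` is positive, `weight * y'` increases from its limit `L ≥ 0`, so that `y`
increases; hence there is no first zero. -/
lemma positiveIncreasing_of_solution (ha : 0 < a) (hb : 0 ≤ b)
    (hy : ∀ x > 0, HasDerivAt y (v x) x)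
    (hv : ∀ x > 0, HasDerivAt v (((a * x + b) * y x - (c * x + d) * v x) / x ^ 2) x)
    (hpos : ∀ᶠ x in 𝓝[>] (0 : ℝ), 0 < y x)
    (hL : 0 ≤ L) (hlim : Tendsto (fun x => dcheWeight c d x * v x) (𝓝[>] 0) (𝓝 L)) :
    PositiveIncreasing y := by
  have hmono : ∀ X > 0, (∀ s ∈ Set.Ioo 0 X, 0 < y s) → StrictMonoOn y (Set.Ioc 0 X) := by
    intro X hX h
    refine strictMonoOn_of_deriv_pos (convex_Ioc _ _)
      (fun s hs => (hy s hs.1).continuousAt.continuousWithinAt) fun s hs => ?_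
    rw [interior_Ioc] at hs
    rw [(hy s hs.1).deriv]
    exact deriv_pos_of_solution_pos ha hb hv hL hlim h hs
  have hall : ∀ x : ℝ, 0 < x → 0 < y x := by
    by_contra! hneg
    obtain ⟨X, hX, hyX⟩ := hneg
    obtain ⟨δ, hδ, h1⟩ := mem_nhdsGT_iff_exists_Ioo_subset.1 hpos
    have hδ : 0 < δ := hδ
    have hδX : δ ≤ X := by
      by_contra! h
      exact absurd (show 0 < y X from h1 ⟨hX, h⟩) (not_lt.2 hyX)
    have hcont : ContinuousOn y (Set.Icc (δ / 2) X) :=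
      fun s hs => (hy s (by linarith [hs.1])).continuousAt.continuousWithinAt
    obtain ⟨x₀, hx₀, hleast⟩ := (isCompact_Icc.of_isClosed_subset
      (hcont.preimage_isClosed_of_isClosed isClosed_Icc (isClosed_Iic (a := (0 : ℝ))))
      Set.inter_subset_left).exists_isLeast ⟨X, ⟨by linarith, le_rfl⟩, hyX⟩
    have hx₀0 : 0 < x₀ := by linarith [hx₀.1.1]
    have hbefore : ∀ s ∈ Set.Ioo 0 x₀, 0 < y s := by
      intro s hs
      rcases lt_or_ge s (δ / 2) with h | h
      · exact h1 ⟨hs.1, by linarith⟩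
      · by_contra! hys
        exact absurd (hleast ⟨⟨h, hs.2.le.trans hx₀.1.2⟩, hys⟩) (not_le.2 hs.2)
    have hlt := hmono x₀ hx₀0 hbefore ⟨half_pos hx₀0, by linarith⟩ ⟨hx₀0, le_rfl⟩
      (half_lt_self hx₀0)
    have h2 := hbefore (x₀ / 2) ⟨half_pos hx₀0, half_lt_self hx₀0⟩
    exact absurd (show y x₀ ≤ 0 from hx₀.2) (not_le.2 (h2.trans hlt))
  exact ⟨hall, fun s hs t ht hst =>
    hmono t ht (fun r hr => hall r hr.1) ⟨hs, hst.le⟩ ⟨ht, le_rfl⟩ hst⟩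

end Positivity

/-! ### The transformation exchanging the two signs of `d` -/

lemma IsDCHESolution.hasDerivAt {a b c d : ℝ} {y : ℝ → ℝ} (h : IsDCHESolution a b c d y) :
    (∀ x > 0, HasDerivAt y (deriv y x) x) ∧ ∀ x > 0, HasDerivAt (deriv y)
      (((a * x + b) * y x - (c * x + d) * deriv y x) / x ^ 2) x := by
  refine ⟨fun x hx => (h x hx).1.hasDerivAt, fun x hx => ?_⟩
  refine (h x hx).2.1.hasDerivAt.congr_deriv ?_
  rw [eq_div_iff (pow_ne_zero 2 (ne_of_gt hx))]
  linear_combination (h x hx).2.2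

lemma isDCHESolution_of_hasDerivAt {a b c d : ℝ} {y v : ℝ → ℝ}
    (hy : ∀ x > 0, HasDerivAt y (v x) x)
    (hv : ∀ x > 0, HasDerivAt v (((a * x + b) * y x - (c * x + d) * v x) / x ^ 2) x) :
    IsDCHESolution a b c d y := by
  intro x hx
  have h1 : HasDerivAt (deriv y) (((a * x + b) * y x - (c * x + d) * v x) / x ^ 2) x := by
    refine (hv x hx).congr_of_eventuallyEq ?_
    filter_upwards [Ioi_mem_nhds hx] with s hs using (hy s hs).deriv
  refine ⟨(hy x hx).differentiableAt, h1.differentiableAt, ?_⟩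
  rw [h1.deriv, (hy x hx).deriv]
  field_simp
  ring

/-- Multiplication by `exp (d / x) * x ^ (2 - c)` maps the solutions of the equation with parameters
`a, b - 2 + c, 4 - c, -d` to solutions of the equation with parameters `a, b, c, d`. -/
lemma hasDerivAt_conjugate {a b c d : ℝ} {u u' : ℝ → ℝ} (hu : ∀ x > 0, HasDerivAt u (u' x) x)
    (hu' : ∀ x > 0, HasDerivAt u'
      (((a * x + (b - 2 + c)) * u x - ((4 - c) * x + -d) * u' x) / x ^ 2) x) :
    (∀ x > 0, HasDerivAt (fun x => dcheWeight (2 - c) (-d) x * u x)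
      (dcheWeight (2 - c) (-d) x * (u' x + ((2 - c) * x + -d) / x ^ 2 * u x)) x) ∧
    (∀ x > 0, HasDerivAt
      (fun x => dcheWeight (2 - c) (-d) x * (u' x + ((2 - c) * x + -d) / x ^ 2 * u x))
      (((a * x + b) * (dcheWeight (2 - c) (-d) x * u x) - (c * x + d) *
        (dcheWeight (2 - c) (-d) x * (u' x + ((2 - c) * x + -d) / x ^ 2 * u x))) / x ^ 2) x) := by
  refine ⟨fun x hx => ?_, fun x hx => ?_⟩
  · refine ((hasDerivAt_dcheWeight (2 - c) (-d) hx).mul (hu x hx)).congr_deriv ?_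
    ring
  · have h1 := (((hasDerivAt_id x).const_mul (2 - c)).add_const (-d)).div (hasDerivAt_pow 2 x)
      (pow_ne_zero 2 (ne_of_gt hx))
    refine ((hasDerivAt_dcheWeight (2 - c) (-d) hx).mul
      ((hu' x hx).add (h1.mul (hu x hx)))).congr_deriv ?_
    simp only [Pi.add_apply, Pi.mul_apply, Pi.div_apply, id]
    field_simp
    push_cast
    ring

lemma coeffNeg_eq_coeffPos (a b c d : ℝ) :
    coeffNeg a b c d = coeffPos a (b - 2 + c) (4 - c) (-d) := by
  unfold coeffNeg coeffPos
  congr 1 <;> funext k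
  · rw [mul_neg, div_neg, ← neg_div]
    congr 1
    ring
  · rw [mul_neg, div_neg]

lemma exp_mul_rpow_eq_dcheWeight (c d x : ℝ) :
    Real.exp (d / x) * x ^ (2 - c) = dcheWeight (2 - c) (-d) x := by
  rw [dcheWeight, neg_neg, mul_comm]

lemma IsDCHESolution.eqOn {a b c d : ℝ} (hd : 0 < d) {y z : ℝ → ℝ}
    (hy : IsDCHESolution a b c d y) (hz : IsDCHESolution a b c d z)
    (h : (fun x => z x - y x) =O[𝓝[>] 0] fun x => x) : Set.EqOn z y (Set.Ioi 0) := by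
  intro x hx
  refine sub_eq_zero.1 (solution_eq_zero (a := a) (b := b) (c := c)
    (w := fun x => z x - y x) (v := fun x => deriv z x - deriv y x) hd
    (fun x hx => (hz.hasDerivAt.1 x hx).sub (hy.hasDerivAt.1 x hx))
    (fun x hx => ((hz.hasDerivAt.2 x hx).sub (hy.hasDerivAt.2 x hx)).congr_deriv ?_) h hx)
  ring

/-! ### Symbol classes and the exponential prefactor -/

/-- `F` is a sequence of successive derivatives on `(0, ∞)`, the `i`-th of which is `O(x ^ (n - i))`
at `0`: its first member behaves like `x ^ n` under differentiation of any order. -/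
def IsSymbolTower (n : ℤ) (F : ℕ → ℝ → ℝ) : Prop :=
  (∀ i, ∀ x > 0, HasDerivAt (F i) (F (i + 1) x) x) ∧
    ∀ i : ℕ, F i =O[𝓝[>] 0] fun x => x ^ (n - (i : ℤ))

/-- The successive derivatives of `F 0 x / x`, in terms of the successive derivatives `F` of
`F 0`; the recursion is the Leibniz rule for the product of `x` and `F 0 x / x`. -/
noncomputable def divTower (F : ℕ → ℝ → ℝ) : ℕ → ℝ → ℝ
  | 0 => fun x => F 0 x / x
  | i + 1 => fun x => (F (i + 1) x - (i + 1) * divTower F i x) / x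

lemma IsSymbolTower.div {n : ℤ} {F : ℕ → ℝ → ℝ} (h : IsSymbolTower n F) :
    IsSymbolTower (n - 1) (divTower F) := by
  have hdiv : ∀ {f : ℝ → ℝ} {k : ℤ}, f =O[𝓝[>] 0] (fun x => x ^ k) →
      (fun x => f x / x) =O[𝓝[>] 0] fun x => x ^ (k - 1) := by
    intro f k hf
    refine (hf.mul (isBigO_refl (fun x : ℝ => x⁻¹) (𝓝[>] 0))).congr' ?_ ?_
    · exact Eventually.of_forall fun x => (div_eq_mul_inv _ _).symm
    · filter_upwards [self_mem_nhdsWithin] with x hx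
      rw [zpow_sub_one₀ (ne_of_gt hx)]
  refine ⟨fun i => ?_, fun i => ?_⟩
  · induction i with
    | zero =>
      intro x hx
      refine ((h.1 0 x hx).div (hasDerivAt_id x) (ne_of_gt hx)).congr_deriv ?_
      simp only [divTower, id]
      field_simp
      push_cast
      ring
    | succ i ih =>
      intro x hx
      refine (((h.1 (i + 1) x hx).sub ((ih x hx).const_mul ((i : ℝ) + 1))).div
        (hasDerivAt_id x) (ne_of_gt hx)).congr_deriv ?_
      simp only [divTower, id, Pi.sub_apply]
      field_simp
      push_cast
      ring
  · induction i with
    | zero => simpa using! hdiv (h.2 0)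
    | succ i ih =>
      have h1 := h.2 (i + 1)
      have e : n - 1 - (i : ℤ) = n - ((i + 1 : ℕ) : ℤ) := by push_cast; ring
      rw [e] at ih
      have := hdiv (h1.sub (ih.const_mul_left ((i : ℝ) + 1)))
      rwa [show n - ((i + 1 : ℕ) : ℤ) - 1 = n - 1 - ((i + 1 : ℕ) : ℤ) by ring] at this

/-- Each differentiation of `exp (d / x) * x ^ (2 - c) * f` lowers the order of the factor `f`
by `2`. -/
lemma IsSymbolTower.iteratedDeriv_mul {n : ℤ} {F : ℕ → ℝ → ℝ} (h : IsSymbolTower n F) (c d : ℝ)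
    (m : ℕ) : ∃ G, IsSymbolTower (n - 2 * m) G ∧ ∀ x > 0,
      iteratedDeriv m (fun x => dcheWeight c d x * F 0 x) x = dcheWeight c d x * G 0 x := by
  induction m with
  | zero => exact ⟨F, by simpa using h, by simp⟩
  | succ m ih =>
    obtain ⟨G, hG, hGm⟩ := ih
    have hG1 := hG.div
    have hG2 := hG1.div
    refine ⟨fun i x => G (i + 1) x + (c * divTower G i x + d * divTower (divTower G) i x),
      ⟨fun i x hx => (hG.1 (i + 1) x hx).add
        (((hG1.1 i x hx).const_mul c).add ((hG2.1 i x hx).const_mul d)), fun i => ?_⟩, ?_⟩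
    · have hmono : ∀ {j k : ℤ}, j ≤ k →
          (fun x : ℝ => x ^ k) =O[𝓝[>] 0] fun x => x ^ j := by
        intro j k hjk
        refine IsBigO.of_bound 1 ?_
        filter_upwards [Ioc_mem_nhdsGT (zero_lt_one (α := ℝ))] with x hx
        rw [one_mul, norm_zpow, norm_zpow, Real.norm_of_nonneg hx.1.le]
        exact zpow_le_zpow_right_of_le_one₀ hx.1 hx.2 hjk
      refine ((hG.2 (i + 1)).trans (hmono ?_)).add
        ((((hG1.2 i).trans (hmono ?_)).const_mul_left c).add
        (((hG2.2 i).trans (hmono ?_)).const_mul_left d)) <;> push_cast <;> omega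
    · intro x hx
      have h1 : HasDerivAt (iteratedDeriv m fun x => dcheWeight c d x * F 0 x) _ x :=
        ((hasDerivAt_dcheWeight c d hx).mul (hG.1 0 x hx)).congr_of_eventuallyEq (by
          filter_upwards [Ioi_mem_nhds hx] with s hs using hGm s hs)
      rw [iteratedDeriv_succ, h1.deriv]
      simp only [divTower]
      field_simp
      ring

lemma TermwiseDiffPos.conjugate {A : ℕ → ℝ} {u : ℝ → ℝ} (h : TermwiseDiffPos A u) (c d : ℝ) :
    TermwiseDiffNeg c d A (fun x => dcheWeight (2 - c) (-d) x * u x) := by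
  simp only [TermwiseDiffNeg, exp_mul_rpow_eq_dcheWeight]
  refine ⟨fun x hx => ((contDiffAt_dcheWeight _ _ hx).mul
    (h.1.contDiffAt (Ioi_mem_nhds hx))).contDiffWithinAt, fun m n => ?_⟩
  have hmon : ∀ k, ContDiff ℝ ∞ fun x : ℝ => A k * x ^ k := fun k => by fun_prop
  have htower : IsSymbolTower n fun i x =>
      iteratedDeriv i u x - ∑ k ∈ Finset.range n, iteratedDeriv i (fun x => A k * x ^ k) x :=
    ⟨fun i x hx => (hasDerivAt_iteratedDeriv h.1 i hx).sub (HasDerivAt.fun_sum fun k _ =>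
      hasDerivAt_iteratedDeriv (hmon k).contDiffOn i hx), fun i => h.2 i n⟩
  obtain ⟨G, hG, hGm⟩ := htower.iteratedDeriv_mul (2 - c) (-d) m
  have hO := (isBigO_refl (dcheWeight (2 - c) (-d)) (𝓝[>] 0)).mul (hG.2 0)
  simp only [Nat.cast_zero, sub_zero] at hO
  refine hO.congr' ?_ EventuallyEq.rfl
  filter_upwards [self_mem_nhdsWithin] with x hx
  have hx : 0 < x := hx
  have hle : ((m : ℕ∞) : WithTop ℕ∞) ≤ ∞ := by exact_mod_cast le_top
  rw [← hGm x hx, ← iteratedDeriv_fun_sum fun k _ =>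
    (contDiffAt_dcheWeight _ _ hx).mul ((hmon k).contDiffAt.of_le hle), ← iteratedDeriv_sub
    ((contDiffAt_dcheWeight _ _ hx).mul ((h.1.contDiffAt (Ioi_mem_nhds hx)).of_le hle))
    (ContDiffAt.sum fun k _ =>
      (contDiffAt_dcheWeight _ _ hx).mul ((hmon k).contDiffAt.of_le hle))]
  congr 1
  funext s
  simp only [iteratedDeriv_zero, Pi.sub_apply, mul_sub, Finset.mul_sum]

/-! ### The two expansions -/

theorem mainTheorem2 (a b c d : ℝ) :
    (0 < d →
      ∃ y : ℝ → ℝ,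
        (IsDCHESolution a b c d y ∧ ExpansionPos (coeffPos a b c d) y) ∧
        (∀ z : ℝ → ℝ, IsDCHESolution a b c d z → ExpansionPos (coeffPos a b c d) z →
          Set.EqOn z y (Set.Ioi 0)) ∧
        TermwiseDiffPos (coeffPos a b c d) y ∧
        (0 < a → 0 ≤ b → PositiveIncreasing y)) ∧
    (d < 0 →
      ∃ y : ℝ → ℝ,
        (IsDCHESolution a b c d y ∧ ExpansionNeg c d (coeffNeg a b c d) y) ∧
        (∀ z : ℝ → ℝ, IsDCHESolution a b c d z → ExpansionNeg c d (coeffNeg a b c d) z →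
          Set.EqOn z y (Set.Ioi 0)) ∧
        TermwiseDiffNeg c d (coeffNeg a b c d) y ∧
        (0 < a → 0 ≤ b → PositiveIncreasing y)) := by
  refine ⟨fun hd => ?_, fun hd => ?_⟩
  · obtain ⟨y, v, hy, hv, hy0, hv0⟩ := exists_solution a b c hd
    have hterm := termwiseDiffPos_of_solution hd hy hv hy0 hv0
    have hexp : ExpansionPos (coeffPos a b c d) y := fun n => by simpa using hterm.2 0 n
    refine ⟨y, ⟨isDCHESolution_of_hasDerivAt hy hv, hexp⟩, fun z hz hzexp => ?_, hterm,
      fun ha hb => ?_⟩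
    · refine (isDCHESolution_of_hasDerivAt hy hv).eqOn hd hz ?_
      simpa using (hzexp 1).sub (hexp 1)
    · refine positiveIncreasing_of_solution ha hb hy hv (hy0.eventually (lt_mem_nhds one_pos))
        le_rfl ?_
      have h := (isBigO_refl (dcheWeight c d) (𝓝[>] 0)).mul hv0
      simp only [mul_one] at h
      exact h.trans_tendsto (tendsto_dcheWeight c hd)
  · obtain ⟨u, u', hu, hu', hu0, hu0'⟩ :=
      exists_solution a (b - 2 + c) (4 - c) (neg_pos.2 hd)
    have hpos := termwiseDiffPos_of_solution (neg_pos.2 hd) hu hu' hu0 hu0'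
    rw [← coeffNeg_eq_coeffPos] at hpos
    obtain ⟨hy, hv⟩ := hasDerivAt_conjugate hu hu'
    have hterm := hpos.conjugate c d
    have hexp : ExpansionNeg c d (coeffNeg a b c d)
        (fun x => dcheWeight (2 - c) (-d) x * u x) := fun n => by simpa using hterm.2 0 n
    refine ⟨_, ⟨isDCHESolution_of_hasDerivAt hy hv, hexp⟩, fun z hz hzexp => ?_, hterm,
      fun ha hb => ?_⟩
    · -- The transformation is an involution on the parameters, hence it also maps `z` to a
      -- solution of the equation satisfied by `u`.
      have hinv : ∀ x > 0, dcheWeight (2 - (4 - c)) (- -d) x * dcheWeight (2 - c) (-d) x = 1 :=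
        fun x hx => by
          rw [dcheWeight_mul_dcheWeight _ _ _ _ hx, dcheWeight]
          ring_nf
          simp
      obtain ⟨hz1, hz2⟩ := hasDerivAt_conjugate (a := a) (b := b - 2 + c) (c := 4 - c) (d := -d)
        (u := z) (u' := deriv z) hz.hasDerivAt.1 (fun x hx => by
          convert hz.hasDerivAt.2 x hx using 3 <;> ring)
      have heq := (isDCHESolution_of_hasDerivAt hu hu').eqOn (neg_pos.2 hd)
        (isDCHESolution_of_hasDerivAt hz1 hz2) (by
          have h1 := (hzexp 1).sub (hexp 1)
          simp only [exp_mul_rpow_eq_dcheWeight, sub_sub_sub_cancel_right] at h1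
          refine ((isBigO_refl (dcheWeight (2 - (4 - c)) (- -d)) (𝓝[>] 0)).mul h1).congr' ?_ ?_
          · filter_upwards [self_mem_nhdsWithin] with x hx
            linear_combination (-u x) * hinv x hx
          · filter_upwards [self_mem_nhdsWithin] with x hx
            linear_combination x * hinv x hx)
      intro x hx
      have h2 : dcheWeight (2 - (4 - c)) (- -d) x * z x = u x := heq hx
      simp only [← h2]
      linear_combination (-z x) * hinv x hx
    · refine positiveIncreasing_of_solution (L := -d) ha hb hy hv ?_ (by linarith) ?_
      · filter_upwards [hu0.eventually (lt_mem_nhds one_pos), self_mem_nhdsWithin] with x h1 hx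
        exact mul_pos (dcheWeight_pos _ _ hx) h1
      · have hid : Tendsto (fun x : ℝ => x) (𝓝[>] 0) (𝓝 0) :=
          tendsto_id.mono_left nhdsWithin_le_nhds
        have h2 : Tendsto (fun x => x ^ 2 * u' x) (𝓝[>] 0) (𝓝 0) := by
          have h := (isBigO_refl (fun x : ℝ => x ^ 2) (𝓝[>] 0)).mul hu0'
          simp only [mul_one] at h
          exact h.trans_tendsto (by simpa using hid.pow 2)
        have h3 := h2.add (((hid.const_mul (2 - c)).add_const (-d)).mul hu0)
        simp only [mul_zero, zero_add, mul_one] at h3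
        refine h3.congr' ?_
        filter_upwards [self_mem_nhdsWithin] with x hx
        have hx : 0 < x := hx
        rw [← mul_assoc, dcheWeight_mul_dcheWeight _ _ _ _ hx, dcheWeight]
        simp only [add_sub_cancel, add_neg_cancel, neg_zero, zero_div, Real.exp_zero, mul_one,
          Real.rpow_two]
        field_simp
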